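/- Let $\Gamma=(V,E,\lambda)$ be a labelled graph: $(V,E)$ is a simple undirected graph with nonempty (finite or infinite) vertex set $V$, and $\lambda:E\to\{2,3,\dots\}$ assigns a label to each edge. The Artin group of $\Gamma$ is $$A(\Gamma)=\langle V \mid \underbrace{abab\cdots}_{\lambda(e)\text{ letters}}=\underbrace{baba\cdots}_{\lambda(e)\text{ letters}}\ \text{ for all } e=\{a,b\}\in E\rangle .$$ For a group $G$ and a finite alphabet $A$, let $G$ act on $A^G$ by $\sigma^g(x)_h=x_{g^{-1}h}$. A pattern is a map $p:P\to A$ with $P\subseteq G$ finite, and it appears in $x\in A^G$ if for some $g\in G$ we have $p_h=x_{gh}$ for all $h\in P$. A subshift of finite type (SFT) on $G$ is the set of all $x\in A^G$ in which no pattern from a given finite set appears. It is weakly aperiodic if each of its configurations has infinite orbit under $\sigma$. If $A(\Gamma)$ is not isomorphic to $\mathbb{Z}$, then $A(\Gamma)$ admits a weakly aperiodic SFT; that is, there exist a finite alphabet $A$ and a nonempty SFT $X\subseteq A^{A(\Gamma)}$ all of whose configurations have infinite orbit under the shift action. -/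

import Mathlib

namespace ArtinSFT

section SymbolicDynamics

open SymbolicDynamics.FullShift

variable {A G : Type*} [Group G]

/-- A set of configurations is a subshift of finite type if it is the set of all configurations
in which no pattern of some finite set `F` of finitely supported patterns appears. -/
def IsSFT [Inhabited A] (X : Set (G → A)) : Prop :=
  ∃ F : Set (Pattern A G), F.Finite ∧ X = mulForbidden F

/-- The left action `(σ^g x)_h = x_{g⁻¹ h}` of `G` on configurations. -/
def shiftAction (g : G) (x : G → A) : G → A :=
  mulShift g⁻¹ x

/-- The orbit of a configuration under the shift action. -/
def orbit (x : G → A) : Set (G → A) :=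
  {y | ∃ g : G, shiftAction g x = y}

/-- A set of configurations is weakly aperiodic if all its elements have infinite orbit. -/
def IsWeaklyAperiodic (X : Set (G → A)) : Prop :=
  ∀ x ∈ X, (orbit x).Infinite

/-- `G` admits a weakly aperiodic SFT: over some finite alphabet there is a nonempty
subshift of finite type all of whose configurations have infinite orbit. -/
def AdmitsWeaklyAperiodicSFT (G : Type*) [Group G] : Prop :=
  ∃ (A : Type) (_ : Finite A) (_ : Inhabited A) (X : Set (G → A)),
    IsSFT X ∧ X.Nonempty ∧ IsWeaklyAperiodic X

end SymbolicDynamics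

section ArtinGroups

/-- The alternating product `a b a b ⋯` with `n` factors, starting with `a`. -/
def alternatingProd {M : Type*} [Monoid M] (a b : M) : ℕ → M
  | 0 => 1
  | n + 1 => a * alternatingProd b a n

variable {V : Type*} (Γ : SimpleGraph V) (lam : Γ.EdgeLabeling {n : ℕ // 2 ≤ n})

/-- The relators `(a b a ⋯) (b a b ⋯)⁻¹`, each of the two words having `λ(e)` letters,
for all edges `e = {a, b}` of the labelled graph. -/
def artinRelators : Set (FreeGroup V) :=
  {r | ∃ (a b : V) (h : Γ.Adj a b),
    r = alternatingProd (FreeGroup.of a) (FreeGroup.of b) (lam.get a b h : ℕ) *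
      (alternatingProd (FreeGroup.of b) (FreeGroup.of a) (lam.get a b h : ℕ))⁻¹}

/-- The Artin group of the labelled graph `(Γ, lam)`. -/
abbrev ArtinGroup : Type _ :=
  PresentedGroup (artinRelators Γ lam)

end ArtinGroups

end ArtinSFT

/-! A weakly aperiodic SFT passes from a subgroup to the whole group
(`AdmitsWeaklyAperiodicSFT.of_injective`), so it suffices to find a copy of the free group of rank
two or of `ℤ²` inside the Artin group.

If there are no edges, either there is one vertex and the group is `ℤ`, or two generators span a
free retract. If `a`, `b` are joined by an edge labelled `m`, then `a` and `b` (for `m = 2`), or `a`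
and the square of the alternating product (for `m ≥ 3`), commute. Their independence follows from
the length homomorphism and the Hecke representation `heckeRep` at `q = 4`. That representation is
defined on the whole Artin group, so no embedding theorem for the subgroup of an edge is needed.

On the free group, a finite orbit would carry a surjective self-map that is at least two-to-one. On
`ℤ²`, rows encode real numbers that are doubled or divided by three, and two periods would force `2
^ a = 3 ^ b` with `a + b > 0`. -/

namespace ArtinSFT

open SymbolicDynamics.FullShift

/-! ### Subshifts of finite type: local rules, passage from subgroups, periods. -/

section SFT

/-- The pushforward of a pattern under an injective map. -/
noncomputable def mapPattern {A X Y : Type*} [Inhabited A] (f : X → Y) (p : Pattern A X) :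
    Pattern A Y := by
  classical
  exact
  { config := fun g => if h : ∃ a ∈ p.support, f a = g then p.config h.choose else default
    support := p.support.image f
    condition := fun g hg => dif_neg (by simpa using hg) }

theorem mapPattern_config {A X Y : Type*} [Inhabited A] {f : X → Y} (hf : Function.Injective f)
    (p : Pattern A X) {a : X} (ha : a ∈ p.support) : (mapPattern f p).config (f a) = p.config a := by
  have h : ∃ b ∈ p.support, f b = f a := ⟨a, ha, rfl⟩
  simp only [mapPattern, dif_pos h]
  rw [hf h.choose_spec.2]

variable {A G H : Type*} [Group G] [Group H]

/-- The configurations all of whose translates satisfy a condition on a finite window form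
a subshift of finite type. -/
theorem isSFT_of_local_rule [Finite A] [Inhabited A] (U : Finset G) (R : (G → A) → Prop)
    (hR : ∀ x y : G → A, (∀ h ∈ U, x h = y h) → R x → R y) :
    IsSFT {x : G → A | ∀ g, R (mulShift g x)} := by
  classical
  -- Outside `U` a pattern takes the default value, so finitely many patterns have support `U`; by
  -- `hR` the default values do not affect `R`.
  refine ⟨{p | p.support = U ∧ ¬ R p.config}, ?_, ?_⟩
  · refine Set.Finite.of_injOn (t := Set.univ) (f := fun p : Pattern A G => fun h : U => p.config h)
      (fun _ _ => Set.mem_univ _) ?_ Set.finite_univ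
    rintro ⟨x, S, hx⟩ ⟨rfl, -⟩ ⟨y, T, hy⟩ ⟨hT, -⟩ hxy
    simp only at hT hxy
    subst hT
    have : x = y := by
      funext h
      by_cases hh : h ∈ T
      · exact congrFun hxy ⟨h, hh⟩
      · rw [hx h hh, hy h hh]
    subst this
    rfl
  · ext x
    constructor
    · rintro hx p ⟨hp, hpR⟩ g hg
      exact hpR (hR _ _ (fun h hh => hg h (hp ▸ hh)) (hx g))
    · intro hx g
      by_contra hg
      refine hx (Pattern.fromConfig (mulShift g x) U) ⟨rfl, fun h => hg (hR _ _ ?_ h)⟩ g ?_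
      · intro h hh
        simp [Pattern.fromConfig, hh]
      · intro h hh
        have hh' : h ∈ U := hh
        simp [Pattern.fromConfig, hh']

theorem mapPattern_occurs [Inhabited A] {f : H →* G} (hf : Function.Injective f)
    (p : Pattern A H) (x : G → A) (g : G) :
    (mapPattern f p).mulOccursInAt x g ↔ p.mulOccursInAt (fun h => x (g * f h)) 1 := by
  classical
  constructor
  · intro hx h hh
    simpa only [one_mul, mapPattern_config hf p hh] using hx (f h) (Finset.mem_image_of_mem f hh)
  · intro hx k hk
    obtain ⟨h, hh, rfl⟩ := Finset.mem_image.1 (show k ∈ p.support.image f from hk)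
    rw [mapPattern_config hf p hh, ← hx h hh, one_mul]

/-- A group containing a subgroup with a weakly aperiodic SFT admits one itself. -/
theorem AdmitsWeaklyAperiodicSFT.of_injective (f : H →* G) (hf : Function.Injective f)
    (hH : AdmitsWeaklyAperiodicSFT H) : AdmitsWeaklyAperiodicSFT G := by
  classical
  obtain ⟨A, hA, hI, X, ⟨F, hF, rfl⟩, ⟨x, hx⟩, hap⟩ := hH
  refine ⟨A, hA, hI, mulForbidden (mapPattern f '' F), ⟨_, hF.image _, rfl⟩, ?_, ?_⟩
  -- Copy `x` onto every left coset of the image of `H`, using a chosen representative as origin.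
  · have hcos : ∀ g : G, ∃ h : H, (QuotientGroup.mk g : G ⧸ f.range).out * f h = g := by
      intro g
      obtain ⟨⟨_, h, rfl⟩, hg⟩ := QuotientGroup.mk_out_eq_mul f.range g
      exact ⟨h⁻¹, by simp [hg]⟩
    choose c hc using hcos
    refine ⟨fun g => x (c g), ?_⟩
    rintro _ ⟨p, hp, rfl⟩ g hg
    rw [mapPattern_occurs hf] at hg
    refine hx p hp (c g) fun h hh => ?_
    rw [← hg h hh, one_mul]
    congr 1
    apply hf
    have h1 : (QuotientGroup.mk (g * f h) : G ⧸ f.range) = QuotientGroup.mk g := by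
      simp
    have h2 := hc (g * f h)
    rw [h1] at h2
    have h3 := hc g
    rw [map_mul]
    apply mul_left_cancel (a := (QuotientGroup.mk g : G ⧸ f.range).out)
    rw [h2, ← mul_assoc, h3]
  · intro y hy hfin
    -- The restriction of `y` to `H` lies in the SFT on `H`, and its `H`-orbit consists of
    -- restrictions of points in the orbit of `y`.
    refine hap (fun h => y (f h)) ?_ ?_
    · intro p hp h hh
      refine hy _ ⟨p, hp, rfl⟩ (f h) ?_
      rw [mapPattern_occurs hf]
      intro k hk
      simpa using hh k hk
    · refine (hfin.image fun z h => z (f h)).subset ?_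
      rintro _ ⟨h, rfl⟩
      exact ⟨_, ⟨f h, rfl⟩, by funext k; simp [shiftAction]⟩

theorem exists_pow_mulShift_eq {x : G → A} (hx : (orbit x).Finite) (g : G) :
    ∃ p : ℕ, 0 < p ∧ mulShift (g ^ p) x = x := by
  have hmem : ∀ n : ℕ, shiftAction (g ^ n) x ∈ orbit x := fun n => ⟨_, rfl⟩
  have hni : ¬ Function.Injective fun n : ℕ => shiftAction (g ^ n) x := fun hinj =>
    Set.infinite_range_of_injective hinj (hx.subset (by rintro _ ⟨n, rfl⟩; exact hmem n))
  obtain ⟨n, m, hnm, hlt⟩ : ∃ n m, shiftAction (g ^ n) x = shiftAction (g ^ m) x ∧ n < m := by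
    simp only [Function.Injective, not_forall] at hni
    obtain ⟨n, m, h, hne⟩ := hni
    rcases lt_or_gt_of_ne hne with hl | hl
    · exact ⟨n, m, h, hl⟩
    · exact ⟨m, n, h.symm, hl⟩
  refine ⟨m - n, by omega, ?_⟩
  have h := congrArg (mulShift (g ^ m)) hnm
  simp only [shiftAction, ← mulShift_mul] at h
  rw [inv_mul_cancel, mulShift_one] at h
  rwa [pow_sub g hlt.le, (Commute.pow_pow_self g m n).inv_right.eq]

end SFT

/-! ### A weakly aperiodic SFT on the free group of rank two. -/

section FreeGroup

/-- The inverse of a letter of a free group. -/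
def invLetter (s : Bool × Bool) : Bool × Bool := (s.1, !s.2)

/-- The element of the free group given by a letter. -/
def letterElt (s : Bool × Bool) : FreeGroup Bool := FreeGroup.mk [s]

theorem letterElt_mul_invLetter (s : Bool × Bool) : letterElt s * letterElt (invLetter s) = 1 := by
  rcases s with ⟨_ | _, _ | _⟩ <;> decide

theorem letterElt_inv (s : Bool × Bool) : (letterElt s)⁻¹ = letterElt (invLetter s) :=
  inv_eq_of_mul_eq_one_right (letterElt_mul_invLetter s)

theorem invLetter_injective : Function.Injective invLetter := by decide

theorem toWord_letterElt_mul (s : Bool × Bool) (g : FreeGroup Bool)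
    (h : ∀ t ∈ g.toWord.head?, t.1 ≠ s.1) : (letterElt s * g).toWord = s :: g.toWord := by
  have h1 : letterElt s * g = FreeGroup.mk (s :: g.toWord) := by
    conv_lhs => rw [← FreeGroup.mk_toWord (x := g)]
    rfl
  rw [h1, FreeGroup.toWord_mk]
  apply FreeGroup.IsReduced.reduce_eq
  have h2 : FreeGroup.IsReduced g.toWord := FreeGroup.isReduced_toWord
  unfold FreeGroup.IsReduced at h2 ⊢
  rw [List.isChain_cons]
  exact ⟨fun t ht hst => absurd hst.symm (h t ht), h2⟩

/-- Each position is pointed to by two distinct neighbours. -/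
def TwoSourcesRule (x : FreeGroup Bool → Bool × Bool) : Prop :=
  ∃ s t, s ≠ t ∧ x (letterElt s) = invLetter s ∧ x (letterElt t) = invLetter t

/-- The free group of rank two admits a weakly aperiodic SFT: the configurations are the maps
moving each element to a neighbour such that each element has at least two preimages. -/
theorem admitsWeaklyAperiodicSFT_freeGroup_bool :
    AdmitsWeaklyAperiodicSFT (FreeGroup Bool) := by
  classical
  refine ⟨Bool × Bool, inferInstance, inferInstance,
    {x | ∀ g, TwoSourcesRule (mulShift g x)}, ?_, ?_, ?_⟩
  · refine isSFT_of_local_rule (Finset.univ.image letterElt) _ ?_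
    rintro x y hxy ⟨s, t, hst, hs, ht⟩
    refine ⟨s, t, hst, ?_, ?_⟩
    · rw [← hxy _ (by simp), hs]
    · rw [← hxy _ (by simp), ht]
  -- Each `g ≠ 1` points to the element obtained by deleting its last letter. The arrow at `1` is
  -- arbitrary, since only incoming arrows are constrained.
  · refine ⟨fun g => g⁻¹.toWord.head?.getD default, fun g => ?_⟩
    have key : ∀ s : Bool × Bool, (∀ t ∈ g⁻¹.toWord.head?, t.1 ≠ s.1) →
        (g * letterElt s)⁻¹.toWord.head?.getD default = invLetter s := by
      intro s hs
      rw [mul_inv_rev, letterElt_inv, toWord_letterElt_mul (invLetter s) _ hs]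
      rfl
    -- For a generator `c` other than that of the last letter of `g`, appending `c` or its inverse
    -- causes no cancellation, so both of these neighbours point back to `g`.
    obtain ⟨c, hc⟩ : ∃ c : Bool, ∀ t ∈ g⁻¹.toWord.head?, t.1 ≠ c := by
      rcases h : g⁻¹.toWord.head? with _ | t
      · exact ⟨true, by simp⟩
      · exact ⟨!t.1, by simp⟩
    exact ⟨(c, true), (c, false), by simp, key _ hc, key _ hc⟩
  · intro x hx hfin
    have hfin' : Finite (orbit x) := hfin
    -- `T` recentres a configuration at the target of the arrow at `1`; the local rule gives every
    -- point two preimages.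
    let T : orbit x → orbit x := fun y => ⟨mulShift (letterElt (y.1 1)) y.1, by
      obtain ⟨g, hg⟩ := y.2
      refine ⟨(letterElt (y.1 1))⁻¹ * g, ?_⟩
      nth_rewrite 3 [← hg]
      rw [shiftAction, shiftAction, ← mulShift_mul]
      simp⟩
    have hT : ∀ y : orbit x, ∃ z w : orbit x, z ≠ w ∧ T z = y ∧ T w = y := by
      rintro ⟨y, g, hg⟩
      have hmem : ∀ s, mulShift (letterElt s) y ∈ orbit x := fun s =>
        ⟨(letterElt s)⁻¹ * g, by rw [← hg, shiftAction, shiftAction, ← mulShift_mul]; simp⟩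
      have hback : ∀ s, y (letterElt s) = invLetter s → T ⟨_, hmem s⟩ = ⟨y, g, hg⟩ := by
        intro s hs
        apply Subtype.ext
        simp only [T, mulShift_apply, mul_one, hs, ← mulShift_mul, letterElt_mul_invLetter,
          mulShift_one]
      obtain ⟨s, t, hst, hs, ht⟩ := hx g⁻¹
      have hs' : y (letterElt s) = invLetter s := by rw [← hg]; exact hs
      have ht' : y (letterElt t) = invLetter t := by rw [← hg]; exact ht
      refine ⟨⟨_, hmem s⟩, ⟨_, hmem t⟩, fun h => hst (invLetter_injective ?_), hback s hs',
        hback t ht'⟩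
      have := congrFun (congrArg Subtype.val h) 1
      simpa [hs', ht'] using this
    have hsurj : Function.Surjective T := fun y => by
      obtain ⟨z, _, _, hz, _⟩ := hT y
      exact ⟨z, hz⟩
    have hinj := Finite.injective_iff_surjective.2 hsurj
    obtain ⟨z, w, hzw, hz, hw⟩ := hT ⟨x, 1, by simp [shiftAction]⟩
    exact hzw (hinj (hz.trans hw.symm))

end FreeGroup

/-! ### A weakly aperiodic SFT on `ℤ²` from multiplication by `2` and `1/3`. -/

section Plane

/-- The permutation `x ↦ 2x` on `[1, 3)`, `x ↦ x / 3` on `[3, 6)` of the interval `[1, 6)`. -/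
noncomputable def scalingPerm : Equiv.Perm (Set.Ico (1 : ℝ) 6) where
  toFun x := if h : x.1 < 3 then ⟨2 * x.1, by have := x.2.1; constructor <;> linarith⟩
    else ⟨x.1 / 3, by have := x.2.2; constructor <;> linarith⟩
  invFun x := if h : x.1 < 2 then ⟨3 * x.1, by have := x.2.1; constructor <;> linarith⟩
    else ⟨x.1 / 2, by have := x.2.2; constructor <;> linarith⟩
  left_inv x := by
    obtain ⟨x, h1, h6⟩ := x
    by_cases h : x < 3
    · have h2 : ¬ 2 * x < 2 := by linarith
      simp [h, h2]
    · have h2 : x / 3 < 2 := by linarith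
      simp only [h, h2, dite_false, dite_true]
      exact Subtype.ext (by simp only; ring)
  right_inv x := by
    obtain ⟨x, h1, h6⟩ := x
    by_cases h : x < 2
    · have h2 : ¬ 3 * x < 3 := by linarith
      simp [h, h2]
    · have h2 : x / 2 < 3 := by linarith
      simp only [h, h2, dite_false, dite_true]
      exact Subtype.ext (by simp only; ring)

/-- A bi-infinite orbit of the scaling map. -/
noncomputable def scalingOrbit (j : ℤ) : ℝ := ((scalingPerm ^ j) ⟨1, by norm_num⟩).1

theorem scalingOrbit_mem (j : ℤ) : 1 ≤ scalingOrbit j ∧ scalingOrbit j < 6 :=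
  ((scalingPerm ^ j) ⟨1, by norm_num⟩).2

theorem scalingOrbit_succ (j : ℤ) :
    scalingOrbit (j + 1) = if scalingOrbit j < 3 then 2 * scalingOrbit j
      else scalingOrbit j / 3 := by
  have h : ((scalingPerm ^ (j + 1)) ⟨1, by norm_num⟩) =
      scalingPerm ((scalingPerm ^ j) ⟨1, by norm_num⟩) := by
    rw [add_comm, zpow_add, zpow_one, Equiv.Perm.mul_apply]
  unfold scalingOrbit
  rw [h]
  generalize (scalingPerm ^ j) ⟨1, by norm_num⟩ = y
  by_cases hy : y.1 < 3 <;> simp [scalingPerm, hy]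

/-- The `i`-th term of the balanced representation of `x`. -/
noncomputable def balancedDigit (x : ℝ) (i : ℤ) : ℤ := ⌊((i + 1 : ℤ) : ℝ) * x⌋ - ⌊(i : ℝ) * x⌋

theorem balancedDigit_mem {x : ℝ} (h1 : 1 ≤ x) (h6 : x < 6) (i : ℤ) :
    balancedDigit x i ∈ Finset.Icc (1 : ℤ) 6 := by
  have a1 := Int.floor_le (((i + 1 : ℤ) : ℝ) * x)
  have a2 := Int.lt_floor_add_one (((i + 1 : ℤ) : ℝ) * x)
  have b1 := Int.floor_le ((i : ℝ) * x)
  have b2 := Int.lt_floor_add_one ((i : ℝ) * x)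
  have e : ((i + 1 : ℤ) : ℝ) * x = i * x + x := by push_cast; ring
  have c1 : (0 : ℝ) < ((balancedDigit x i : ℤ) : ℝ) := by
    unfold balancedDigit; push_cast at *; linarith
  have c2 : ((balancedDigit x i : ℤ) : ℝ) < 7 := by
    unfold balancedDigit; push_cast at *; linarith
  rw [Finset.mem_Icc]
  have c1' : 0 < balancedDigit x i := by exact_mod_cast c1
  have c2' : balancedDigit x i < 7 := by exact_mod_cast c2
  omega

/-- The carry at position `i` when `x` is multiplied by `2` or divided by `3`. -/
noncomputable def carry (x : ℝ) (i : ℤ) : ℤ :=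
  if x < 3 then 2 * ⌊(i : ℝ) * x⌋ - ⌊(i : ℝ) * (2 * x)⌋
  else ⌊(i : ℝ) * x⌋ - 3 * ⌊(i : ℝ) * (x / 3)⌋

theorem carry_mem (x : ℝ) (i : ℤ) : carry x i ∈ Finset.Icc (-1 : ℤ) 2 := by
  have b1 := Int.floor_le ((i : ℝ) * x)
  have b2 := Int.lt_floor_add_one ((i : ℝ) * x)
  rw [Finset.mem_Icc]
  unfold carry
  split_ifs
  · have a1 := Int.floor_le ((i : ℝ) * (2 * x))
    have a2 := Int.lt_floor_add_one ((i : ℝ) * (2 * x))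
    have c1 : (-2 : ℝ) < ((2 * ⌊(i : ℝ) * x⌋ - ⌊(i : ℝ) * (2 * x)⌋ : ℤ) : ℝ) := by
      push_cast; linarith
    have c2 : ((2 * ⌊(i : ℝ) * x⌋ - ⌊(i : ℝ) * (2 * x)⌋ : ℤ) : ℝ) < 1 := by
      push_cast; linarith
    have c1' : -2 < 2 * ⌊(i : ℝ) * x⌋ - ⌊(i : ℝ) * (2 * x)⌋ := by exact_mod_cast c1
    have c2' : 2 * ⌊(i : ℝ) * x⌋ - ⌊(i : ℝ) * (2 * x)⌋ < 1 := by exact_mod_cast c2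
    omega
  · have a1 := Int.floor_le ((i : ℝ) * (x / 3))
    have a2 := Int.lt_floor_add_one ((i : ℝ) * (x / 3))
    have c1 : (-1 : ℝ) < ((⌊(i : ℝ) * x⌋ - 3 * ⌊(i : ℝ) * (x / 3)⌋ : ℤ) : ℝ) := by
      push_cast; linarith
    have c2 : ((⌊(i : ℝ) * x⌋ - 3 * ⌊(i : ℝ) * (x / 3)⌋ : ℤ) : ℝ) < 3 := by
      push_cast; linarith
    have c1' : -1 < ⌊(i : ℝ) * x⌋ - 3 * ⌊(i : ℝ) * (x / 3)⌋ := by exact_mod_cast c1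
    have c2' : ⌊(i : ℝ) * x⌋ - 3 * ⌊(i : ℝ) * (x / 3)⌋ < 3 := by exact_mod_cast c2
    omega

/-- Tiles: whether the row is doubled, the digit, and the carry on the left side. -/
abbrev ScalingTile : Type := Bool × Finset.Icc (1 : ℤ) 6 × Finset.Icc (-1 : ℤ) 2

instance : Inhabited ScalingTile := ⟨(true, ⟨1, by decide⟩, ⟨0, by decide⟩)⟩

/-- The free abelian group of rank two, written multiplicatively. -/
abbrev Plane : Type := Multiplicative (ℤ × ℤ)

/-- The local rule: the row type is constant along rows, and each row is two times or one third
of the previous one, up to carries. -/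
def ScalingRule (x : Plane → ScalingTile) : Prop :=
  (x (.ofAdd (1, 0))).1 = (x 1).1 ∧
  if (x 1).1 then
    ((x 1).2.2 : ℤ) + 2 * (x 1).2.1 = (x (.ofAdd (1, 0))).2.2 + (x (.ofAdd (0, 1))).2.1
  else
    ((x 1).2.2 : ℤ) + (x 1).2.1 = (x (.ofAdd (1, 0))).2.2 + 3 * (x (.ofAdd (0, 1))).2.1

/-- The scaling tile at a position in the configuration given by a bi-infinite orbit. -/
noncomputable def scalingConfig (v : Plane) : ScalingTile :=
  (decide (scalingOrbit v.toAdd.2 < 3),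
    ⟨balancedDigit (scalingOrbit v.toAdd.2) v.toAdd.1,
      balancedDigit_mem (scalingOrbit_mem _).1 (scalingOrbit_mem _).2 _⟩,
    ⟨carry (scalingOrbit v.toAdd.2) v.toAdd.1, carry_mem _ _⟩)

/-- Digits are differences of consecutive floors, and each carry is the discrepancy between the
scaled floor of one row and the floor of the next, so the rule is an identity between floors. -/
theorem scalingRule_scalingConfig (g : Plane) : ScalingRule (mulShift g scalingConfig) := by
  obtain ⟨⟨i, j⟩, rfl⟩ := Multiplicative.ofAdd.surjective g
  have e1 : (Multiplicative.ofAdd (i, j) * Multiplicative.ofAdd ((1, 0) : ℤ × ℤ)) =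
    Multiplicative.ofAdd (i + 1, j) := by rw [← ofAdd_add]; simp
  have e2 : (Multiplicative.ofAdd (i, j) * Multiplicative.ofAdd ((0, 1) : ℤ × ℤ)) =
    Multiplicative.ofAdd (i, j + 1) := by rw [← ofAdd_add]; simp
  have hs := scalingOrbit_succ j
  simp only [ScalingRule, mulShift_apply, mul_one, e1, e2, scalingConfig, toAdd_ofAdd]
  refine ⟨trivial, ?_⟩
  by_cases h : scalingOrbit j < 3
  · simp only [h, decide_true, if_true] at hs ⊢
    simp only [balancedDigit, carry, h, if_true, hs]
    ring
  · simp only [h, decide_false, if_false] at hs ⊢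
    simp only [balancedDigit, carry, h, if_false, hs, Bool.false_eq_true]
    ring

/-- The sum of the digits over a stretch of `p` tiles of the `j`-th row. -/
def rowSum (x : Plane → ScalingTile) (p j : ℕ) : ℤ :=
  ∑ i ∈ Finset.range p, ((x (.ofAdd ((i : ℤ), (j : ℤ)))).2.1 : ℤ)

/-- Summing the rule over one horizontal period makes the carries telescope to zero; the row type is
the same for all the tiles involved. -/
theorem rowSum_succ {x : Plane → ScalingTile} (hx : ∀ g, ScalingRule (mulShift g x)) {p : ℕ}
    (hp : mulShift (.ofAdd ((p : ℤ), 0)) x = x) (j : ℕ) :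
    2 * rowSum x p j = rowSum x p (j + 1) ∨ rowSum x p j = 3 * rowSum x p (j + 1) := by
  have hrule : ∀ i : ℕ, (x (.ofAdd (((i + 1 : ℕ) : ℤ), (j : ℤ)))).1 =
      (x (.ofAdd ((i : ℤ), (j : ℤ)))).1 ∧
      if (x (.ofAdd ((i : ℤ), (j : ℤ)))).1 then
        ((x (.ofAdd ((i : ℤ), (j : ℤ)))).2.2 : ℤ) + 2 * (x (.ofAdd ((i : ℤ), (j : ℤ)))).2.1 =
          (x (.ofAdd (((i + 1 : ℕ) : ℤ), (j : ℤ)))).2.2 +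
            (x (.ofAdd ((i : ℤ), ((j + 1 : ℕ) : ℤ)))).2.1
      else
        ((x (.ofAdd ((i : ℤ), (j : ℤ)))).2.2 : ℤ) + (x (.ofAdd ((i : ℤ), (j : ℤ)))).2.1 =
          (x (.ofAdd (((i + 1 : ℕ) : ℤ), (j : ℤ)))).2.2 +
            3 * (x (.ofAdd ((i : ℤ), ((j + 1 : ℕ) : ℤ)))).2.1 := by
    intro i
    have h := hx (.ofAdd ((i : ℤ), (j : ℤ)))
    simpa only [ScalingRule, mulShift_apply, mul_one, ← ofAdd_add, Prod.mk_add_mk, add_zero,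
      Nat.cast_add, Nat.cast_one] using h
  have htype : ∀ i : ℕ, (x (.ofAdd ((i : ℤ), (j : ℤ)))).1 = (x (.ofAdd (0, (j : ℤ)))).1 := by
    intro i
    induction i with
    | zero => rfl
    | succ i ih => rw [(hrule i).1, ih]
  have hper : (x (.ofAdd ((p : ℤ), (j : ℤ)))) = x (.ofAdd (0, (j : ℤ))) := by
    have h := congrFun hp (.ofAdd (0, (j : ℤ)))
    simpa only [mulShift_apply, ← ofAdd_add, Prod.mk_add_mk, add_zero, zero_add] using h
  have htel := Finset.sum_range_sub
    (fun i : ℕ => ((x (.ofAdd ((i : ℤ), (j : ℤ)))).2.2 : ℤ)) p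
  simp only [hper, Nat.cast_zero, sub_self] at htel
  cases hb : (x (.ofAdd (0, (j : ℤ)))).1
  · right
    simp only [htype, hb, Bool.false_eq_true, if_false] at hrule
    rw [← sub_eq_zero, ← htel, rowSum, rowSum, Finset.mul_sum, ← Finset.sum_sub_distrib]
    exact Finset.sum_congr rfl fun i _ => by linarith [(hrule i).2]
  · left
    simp only [htype, hb, if_true] at hrule
    rw [← sub_eq_zero, ← htel, rowSum, rowSum, Finset.mul_sum, ← Finset.sum_sub_distrib]
    exact Finset.sum_congr rfl fun i _ => by linarith [(hrule i).2]

/-- The free abelian group of rank two admits a weakly aperiodic SFT. -/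
theorem admitsWeaklyAperiodicSFT_plane : AdmitsWeaklyAperiodicSFT Plane := by
  classical
  refine ⟨ScalingTile, inferInstance, inferInstance, {x | ∀ g, ScalingRule (mulShift g x)}, ?_,
    ⟨scalingConfig, scalingRule_scalingConfig⟩, ?_⟩
  · refine isSFT_of_local_rule {1, .ofAdd (1, 0), .ofAdd (0, 1)} _ fun x y hxy hx => ?_
    unfold ScalingRule at hx ⊢
    rwa [← hxy 1 (by simp), ← hxy (.ofAdd (1, 0)) (by simp), ← hxy (.ofAdd (0, 1)) (by simp)]
  · intro x hx hfin
    obtain ⟨p, hp0, hp⟩ := exists_pow_mulShift_eq hfin (.ofAdd (1, 0))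
    obtain ⟨r, hr0, hr⟩ := exists_pow_mulShift_eq hfin (.ofAdd (0, 1))
    rw [← ofAdd_nsmul] at hp hr
    have hp' : mulShift (.ofAdd ((p : ℤ), 0)) x = x := by simpa using hp
    have hpos : ∀ j, 0 < rowSum x p j := fun j =>
      Finset.sum_pos (fun i _ => by
        have := (Finset.mem_Icc.1 (x (.ofAdd ((i : ℤ), (j : ℤ)))).2.1.2).1
        linarith) ⟨0, by simpa using hp0⟩
    have hprod : ∀ j, ∃ a b : ℕ, a + b = j ∧ 2 ^ a * rowSum x p 0 = 3 ^ b * rowSum x p j := by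
      intro j
      induction j with
      | zero => exact ⟨0, 0, rfl, by simp⟩
      | succ j ih =>
        obtain ⟨a, b, hab, h⟩ := ih
        rcases rowSum_succ hx hp' j with h2 | h3
        · exact ⟨a + 1, b, by omega, by rw [← h2, pow_succ]; linear_combination 2 * h⟩
        · exact ⟨a, b + 1, by omega, by rw [h, h3, pow_succ]; ring⟩
    have hper : rowSum x p r = rowSum x p 0 := by
      unfold rowSum
      refine Finset.sum_congr rfl fun i _ => ?_
      have h := congrFun hr (.ofAdd ((i : ℤ), 0))
      simp only [mulShift_apply, ← ofAdd_add] at h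
      simp only [Prod.smul_mk, nsmul_eq_mul, mul_zero, mul_one, Prod.mk_add_mk, zero_add,
        add_zero] at h
      simp [h]
    obtain ⟨a, b, hab, h⟩ := hprod r
    rw [hper] at h
    have h23 : (2 : ℤ) ^ a = 3 ^ b := mul_right_cancel₀ (hpos 0).ne' h
    have ha : a = 0 := by
      by_contra ha
      have h1 : Even ((3 : ℤ) ^ b) := h23 ▸ (even_two.pow_of_ne_zero ha)
      have h2 : Odd ((3 : ℤ) ^ b) := Odd.pow (by decide)
      exact (Int.not_even_iff_odd.2 h2) h1
    have hb : b = 0 := by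
      by_contra hb
      have h1 : (1 : ℤ) < 3 ^ b := one_lt_pow₀ (by norm_num) hb
      rw [← h23, ha] at h1
      simp at h1
    omega

end Plane

/-! ### Braid relations and alternating products of Hecke type. -/

section AlternatingProducts

theorem map_alternatingProd {M N F : Type*} [Monoid M] [Monoid N] [FunLike F M N]
    [MonoidHomClass F M N] (f : F) (a b : M) (n : ℕ) :
    f (alternatingProd a b n) = alternatingProd (f a) (f b) n := by
  induction n generalizing a b with
  | zero => exact map_one f
  | succ n ih => rw [alternatingProd, alternatingProd, map_mul, ih]

theorem alternatingProd_succ_right {M : Type*} [Monoid M] (a b : M) (n : ℕ) :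
    alternatingProd a b (n + 1) = alternatingProd a b n * if Even n then a else b := by
  induction n generalizing a b with
  | zero => simp [alternatingProd]
  | succ n ih =>
    rw [alternatingProd, ih b a, alternatingProd, mul_assoc]
    by_cases h : Even n <;> simp [h, Nat.even_add_one]

theorem alternatingProd_self {M : Type*} [Monoid M] (a : M) (n : ℕ) :
    alternatingProd a a n = a ^ n := by
  induction n with
  | zero => exact (pow_zero a).symm
  | succ n ih => rw [alternatingProd, ih, pow_succ']

/-- In the presence of the braid relation the square of the alternating product commutes with
its first factor. -/
theorem commute_alternatingProd_sq {M : Type*} [Monoid M] {a b : M} {n : ℕ}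
    (h : alternatingProd a b n = alternatingProd b a n) :
    Commute a (alternatingProd a b n * alternatingProd a b n) := by
  -- Moving a letter past the alternating product fixes it for even `n` and swaps `a` with `b` for
  -- odd `n`; doing so twice restores it.
  have h1 : a * alternatingProd a b n = alternatingProd a b n * if Even n then a else b := by
    rw [← alternatingProd_succ_right, alternatingProd, h]
  have h2 : b * alternatingProd a b n = alternatingProd a b n * if Even n then b else a := by
    rw [h, ← alternatingProd_succ_right, alternatingProd, h]
  rw [Commute, SemiconjBy, ← mul_assoc, h1, mul_assoc, mul_assoc]
  congr 1
  by_cases hn : Even n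
  · simpa [hn] using h1
  · simpa [hn] using h2

/-- The coefficients, in the basis `1, E, F, EF, FE`, of the alternating product of `1 - E` and
`1 - F` in an algebra with `E² = (1 + q) E`, `F² = (1 + q) F`, `EFE = κ E`, `FEF = κ F`. -/
def heckeCoeff (q κ : ℝ) : ℕ → ℝ × ℝ × ℝ × ℝ
  | 0 => (0, 0, 0, 0)
  | n + 1 =>
    let c := heckeCoeff q κ n
    (-1 - q * c.2.1 - κ * c.2.2.1, c.1, -c.1 - q * c.2.2.2, c.2.2.1)

theorem alternatingProd_one_sub {R : Type*} [Ring R] [Algebra ℝ R] {q κ : ℝ} {E F : R}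
    (hE : E * E = (1 + q) • E) (hF : F * F = (1 + q) • F)
    (hEF : E * F * E = κ • E) (hFE : F * E * F = κ • F) (n : ℕ) :
    alternatingProd (1 - E) (1 - F) n = 1 + (heckeCoeff q κ n).1 • E + (heckeCoeff q κ n).2.1 • F
      + (heckeCoeff q κ n).2.2.1 • (E * F) + (heckeCoeff q κ n).2.2.2 • (F * E) := by
  induction n generalizing E F with
  | zero => simp [alternatingProd, heckeCoeff]
  | succ n ih =>
    rw [alternatingProd, ih hF hE hFE hEF, heckeCoeff]
    simp only [sub_mul, one_mul, mul_add, mul_one, mul_smul_comm, hE, ← mul_assoc, hEF,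
      smul_mul_assoc]
    module

/-- Interchanging `E` and `F` changes the product only through the differences `d` and `e`. These
satisfy a linear recursion of Chebyshev type, solved by sines of multiples of `θ`; at `θ = π / m`
the `m`-th sine vanishes, which is the braid relation. -/
theorem heckeCoeff_differences (q θ : ℝ) (n : ℕ) :
    let d := fun k => (heckeCoeff q (4 * q * Real.cos θ ^ 2) k).1
      - (heckeCoeff q (4 * q * Real.cos θ ^ 2) k).2.1
    let e := fun k => (heckeCoeff q (4 * q * Real.cos θ ^ 2) k).2.2.1
      - (heckeCoeff q (4 * q * Real.cos θ ^ 2) k).2.2.2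
    (d (2 * n) = 0 ∧
      e (2 * n) * (2 * q * Real.cos θ * Real.sin θ) = q ^ n * Real.sin ((2 * n : ℕ) * θ)) ∧
    (d (2 * n + 1) * Real.sin θ = -q ^ n * Real.sin ((2 * n + 1 : ℕ) * θ) ∧
      e (2 * n + 1) = 0) := by
  intro d e
  have hd : ∀ k, d (k + 2) = -q * d k - 4 * q * Real.cos θ ^ 2 * e (k + 1) := fun k => by
    simp only [d, e, heckeCoeff]; ring
  have he : ∀ k, e (k + 2) = -d (k + 1) - q * e k := fun k => by
    simp only [d, e, heckeCoeff]; ring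
  have hsin : ∀ k : ℕ, Real.sin ((k + 2 : ℕ) * θ) =
      2 * Real.cos θ * Real.sin ((k + 1 : ℕ) * θ) - Real.sin (k * θ) := fun k => by
    have h1 : ((k + 2 : ℕ) : ℝ) * θ = (k + 1 : ℕ) * θ + θ := by push_cast; ring
    have h2 : (k : ℝ) * θ = (k + 1 : ℕ) * θ - θ := by push_cast; ring
    rw [h1, h2, Real.sin_add, Real.sin_sub]; ring
  induction n with
  | zero => simp [d, e, heckeCoeff]
  | succ n ih =>
    obtain ⟨⟨h1, h2⟩, h3, h4⟩ := ih
    have h5 : e (2 * n + 2) * (2 * q * Real.cos θ * Real.sin θ) =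
        q ^ (n + 1) * Real.sin ((2 * n + 2 : ℕ) * θ) := by
      rw [he, hsin]
      linear_combination -(2 * q * Real.cos θ) * h3 - q * h2
    refine ⟨⟨?_, h5⟩, ?_, ?_⟩
    · rw [show 2 * (n + 1) = 2 * n + 2 by ring, hd, h1, h4]; ring
    · rw [show 2 * (n + 1) + 1 = 2 * n + 1 + 2 by ring, hd, hsin]
      linear_combination -q * h3 - 2 * Real.cos θ * h5
    · rw [show 2 * (n + 1) + 1 = 2 * n + 1 + 2 by ring, he,
        show 2 * n + 1 + 1 = 2 * n + 2 by ring, h4, show d (2 * n + 2) = 0 by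
          rw [hd, h1, h4]; ring]
      ring

theorem heckeCoeff_symmetric {q : ℝ} (hq : 0 < q) {m : ℕ} (hm : 3 ≤ m) :
    let c := heckeCoeff q (4 * q * Real.cos (Real.pi / m) ^ 2) m
    c.1 = c.2.1 ∧ c.2.2.1 = c.2.2.2 := by
  have hm3 : (3 : ℝ) ≤ m := by exact_mod_cast hm
  have hpos : 0 < Real.pi / m := by positivity
  have hlt : Real.pi / m < Real.pi / 2 := by
    apply div_lt_div_of_pos_left Real.pi_pos <;> linarith
  have hs : Real.sin (Real.pi / m) ≠ 0 := (Real.sin_pos_of_pos_of_lt_pi hpos (by linarith)).ne'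
  -- The cosine is divided out when `m` is even; this fails for `m = 2`, which is treated separately
  -- in `oneSubUnit_braid_two`.
  have hc : Real.cos (Real.pi / m) ≠ 0 := (Real.cos_pos_of_mem_Ioo ⟨by linarith, hlt⟩).ne'
  have hz : Real.sin (m * (Real.pi / m)) = 0 := by
    rw [mul_div_cancel₀ _ (by linarith), Real.sin_pi]
  rcases Nat.even_or_odd' m with ⟨n, hn | hn⟩
  · obtain ⟨⟨h1, h2⟩, -⟩ := heckeCoeff_differences q (Real.pi / m) n
    rw [← hn] at h1 h2
    rw [hz, mul_zero] at h2
    have h2' := (mul_eq_zero.1 h2).resolve_right (by positivity)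
    exact ⟨sub_eq_zero.1 h1, sub_eq_zero.1 h2'⟩
  · obtain ⟨-, h1, h2⟩ := heckeCoeff_differences q (Real.pi / m) n
    rw [← hn] at h1 h2
    rw [hz, mul_zero] at h1
    exact ⟨sub_eq_zero.1 ((mul_eq_zero.1 h1).resolve_right hs), sub_eq_zero.1 h2⟩

/-- The braid relation of length `m` for generators of Hecke type. -/
theorem alternatingProd_one_sub_comm {R : Type*} [Ring R] [Algebra ℝ R] {q : ℝ} (hq : 0 < q)
    {m : ℕ} (hm : 3 ≤ m) {E F : R} (hE : E * E = (1 + q) • E) (hF : F * F = (1 + q) • F)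
    (hEF : E * F * E = (4 * q * Real.cos (Real.pi / m) ^ 2) • E)
    (hFE : F * E * F = (4 * q * Real.cos (Real.pi / m) ^ 2) • F) :
    alternatingProd (1 - E) (1 - F) m = alternatingProd (1 - F) (1 - E) m := by
  obtain ⟨h1, h2⟩ := heckeCoeff_symmetric hq hm
  rw [alternatingProd_one_sub hE hF hEF hFE, alternatingProd_one_sub hF hE hFE hEF, h1, h2]
  abel

end AlternatingProducts

/-! ### Hecke reflections on the free vector space over the vertices. -/

section Representation

variable {V : Type*}

/-- The rank one operator `x ↦ ⟨B s, x⟩ e_s`. -/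
noncomputable def rankOne (B : V → V → ℝ) (s : V) : Module.End ℝ (V →₀ ℝ) :=
  (Finsupp.linearCombination ℝ (B s)).smulRight (Finsupp.single s 1)

theorem rankOne_single (B : V → V → ℝ) (s t : V) :
    rankOne B s (Finsupp.single t 1) = Finsupp.single s (B s t) := by
  simp [rankOne]

theorem rankOne_apply (B : V → V → ℝ) (s : V) (x : V →₀ ℝ) :
    rankOne B s x = Finsupp.linearCombination ℝ (B s) x • Finsupp.single s 1 := rfl

theorem rankOne_mul_self (B : V → V → ℝ) (s : V) :
    rankOne B s * rankOne B s = B s s • rankOne B s := by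
  refine LinearMap.ext fun x => ?_
  rw [Module.End.mul_apply, LinearMap.smul_apply, rankOne_apply B s x, map_smul, rankOne_single,
    smul_comm, Finsupp.smul_single_one (b := B s s)]

theorem rankOne_mul_mul (B : V → V → ℝ) (s t : V) :
    rankOne B s * rankOne B t * rankOne B s = (B s t * B t s) • rankOne B s := by
  refine LinearMap.ext fun x => ?_
  rw [Module.End.mul_apply, Module.End.mul_apply, LinearMap.smul_apply, rankOne_apply B s x,
    map_smul, map_smul, rankOne_single, ← Finsupp.smul_single_one t, map_smul, rankOne_single,
    ← Finsupp.smul_single_one s (B s t)]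
  module

theorem rankOne_mul_eq_zero {B : V → V → ℝ} {s t : V} (h : B s t = 0) :
    rankOne B s * rankOne B t = 0 := by
  refine LinearMap.ext fun x => ?_
  rw [Module.End.mul_apply, rankOne_apply B t, map_smul, rankOne_single, h, Finsupp.single_zero,
    smul_zero, LinearMap.zero_apply]

/-- The unit `1 - E` of an algebra in which `E² = 5 E`. -/
noncomputable def oneSubUnit {R : Type*} [Ring R] [Algebra ℝ R] (E : R)
    (hE : E * E = (1 + 4 : ℝ) • E) : Rˣ where
  val := 1 - E
  inv := 1 - (1 / 4 : ℝ) • E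
  val_inv := by
    simp only [sub_mul, mul_sub, mul_one, one_mul, mul_smul_comm, hE]
    module
  inv_val := by
    simp only [sub_mul, mul_sub, mul_one, one_mul, smul_mul_assoc, hE]
    module

theorem oneSubUnit_braid {R : Type*} [Ring R] [Algebra ℝ R] {m : ℕ} (hm : 3 ≤ m) {E F : R}
    (hE : E * E = (1 + 4 : ℝ) • E) (hF : F * F = (1 + 4 : ℝ) • F)
    (hEF : E * F * E = (4 * 4 * Real.cos (Real.pi / m) ^ 2) • E)
    (hFE : F * E * F = (4 * 4 * Real.cos (Real.pi / m) ^ 2) • F) :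
    alternatingProd (oneSubUnit E hE) (oneSubUnit F hF) m =
      alternatingProd (oneSubUnit F hF) (oneSubUnit E hE) m := by
  apply Units.ext
  rw [← Units.coeHom_apply, ← Units.coeHom_apply, map_alternatingProd, map_alternatingProd]
  exact alternatingProd_one_sub_comm (by norm_num) hm hE hF hEF hFE

theorem oneSubUnit_braid_two {R : Type*} [Ring R] [Algebra ℝ R] {E F : R}
    (hE : E * E = (1 + 4 : ℝ) • E) (hF : F * F = (1 + 4 : ℝ) • F)
    (hEF : E * F = 0) (hFE : F * E = 0) :
    alternatingProd (oneSubUnit E hE) (oneSubUnit F hF) 2 =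
      alternatingProd (oneSubUnit F hF) (oneSubUnit E hE) 2 := by
  apply Units.ext
  simp only [alternatingProd, mul_one, Units.val_mul, oneSubUnit, sub_mul, mul_sub, one_mul, hEF,
    hFE]
  abel

/-- The reflection with eigenvalue `-4` attached to `s`. -/
noncomputable def heckeReflection (B : V → V → ℝ) (hB : ∀ s, B s s = 1 + 4) (s : V) :
    (Module.End ℝ (V →₀ ℝ))ˣ :=
  oneSubUnit (rankOne B s) (by rw [rankOne_mul_self, hB])

variable {B : V → V → ℝ} {hB : ∀ s, B s s = 1 + 4}

theorem heckeReflection_apply (s : V) (x : V →₀ ℝ) :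
    (heckeReflection B hB s).val x = x - rankOne B s x := rfl

theorem heckeReflection_apply_of_ne {s t : V} (h : t ≠ s) (x : V →₀ ℝ) :
    (heckeReflection B hB s).val x t = x t := by
  simp [heckeReflection_apply, rankOne_apply, h]

theorem heckeReflection_pow_apply_of_ne {s t : V} (h : t ≠ s) (n : ℕ) (x : V →₀ ℝ) :
    ((heckeReflection B hB s).val ^ n) x t = x t := by
  induction n with
  | zero => rfl
  | succ n ih => rw [pow_succ', Module.End.mul_apply, heckeReflection_apply_of_ne h, ih]

theorem heckeReflection_pow_single (s : V) (n : ℕ) :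
    ((heckeReflection B hB s).val ^ n) (Finsupp.single s 1) = (-4 : ℝ) ^ n • .single s 1 := by
  induction n with
  | zero => simp
  | succ n ih =>
    rw [pow_succ', Module.End.mul_apply, ih, map_smul, heckeReflection_apply, rankOne_single, hB,
      pow_succ, mul_smul]
    congr 1
    rw [← Finsupp.single_sub, Finsupp.smul_single]
    norm_num

theorem neg_four_pow_ne_one {n : ℕ} (hn : n ≠ 0) : (-4 : ℝ) ^ n ≠ 1 := by
  intro h
  have h1 := congrArg abs h
  rw [abs_pow, abs_one] at h1
  have h2 : (1 : ℝ) < |-4| ^ n := one_lt_pow₀ (by norm_num) hn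
  linarith

/-- Compare the `b`-coordinates of both products at `e_a`: powers of the reflection in `a` preserve
that coordinate but scale `e_a` by `(-4) ^ n`, which is not `1`. -/
theorem not_commute_heckeReflection_pow {a b : V} (hab : a ≠ b) (h : B b a ≠ 0) {n : ℕ}
    (hn : n ≠ 0) : ¬ Commute (heckeReflection B hB b) (heckeReflection B hB a ^ n) := by
  intro hc
  have h1 := congrArg (fun u : (Module.End ℝ (V →₀ ℝ))ˣ => u.val (Finsupp.single a 1) b) hc.eq
  simp only [Units.val_mul, Units.val_pow_eq_pow_val, Module.End.mul_apply] at h1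
  rw [heckeReflection_pow_apply_of_ne hab.symm, heckeReflection_pow_single, map_smul,
    heckeReflection_apply, rankOne_single] at h1
  simp only [Finsupp.smul_apply, Finsupp.sub_apply, Finsupp.single_eq_same,
    Finsupp.single_eq_of_ne hab.symm, zero_sub, smul_eq_mul] at h1
  exact neg_four_pow_ne_one hn (mul_right_cancel₀ (neg_ne_zero.2 h) (h1.trans (one_mul _).symm))

theorem heckeReflection_pow_ne_pow {a b : V} (hab : a ≠ b) {n : ℕ} (hn : n ≠ 0) :
    heckeReflection B hB a ^ n ≠ heckeReflection B hB b ^ n := by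
  intro hc
  have h1 := congrArg (fun u : (Module.End ℝ (V →₀ ℝ))ˣ => u.val (Finsupp.single a 1) a) hc
  simp only [Units.val_pow_eq_pow_val] at h1
  rw [heckeReflection_pow_apply_of_ne hab, heckeReflection_pow_single] at h1
  simp only [Finsupp.smul_apply, Finsupp.single_eq_same, smul_eq_mul, mul_one] at h1
  exact neg_four_pow_ne_one hn h1

end Representation

/-! ### Subgroups `ℤ²` and free subgroups of Artin groups. -/

section Artin

variable {V : Type*} (Γ : SimpleGraph V) (lam : Γ.EdgeLabeling {n : ℕ // 2 ≤ n})

/-- The homomorphism from an Artin group determined by elements satisfying the braid relations. -/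
def artinLift {G : Type*} [Group G] (f : V → G)
    (hf : ∀ a b (h : Γ.Adj a b), alternatingProd (f a) (f b) (lam.get a b h) =
      alternatingProd (f b) (f a) (lam.get a b h)) : ArtinGroup Γ lam →* G :=
  PresentedGroup.toGroup (f := f) (by
    rintro _ ⟨a, b, h, rfl⟩
    rw [map_mul, map_inv, map_alternatingProd, map_alternatingProd, FreeGroup.lift_apply_of,
      FreeGroup.lift_apply_of, hf a b h, mul_inv_cancel])

/-- The standard generators of an Artin group. -/
def artinGen (a : V) : ArtinGroup Γ lam := PresentedGroup.of a

theorem artinLift_artinGen {G : Type*} [Group G] (f : V → G)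
    (hf : ∀ a b (h : Γ.Adj a b), alternatingProd (f a) (f b) (lam.get a b h) =
      alternatingProd (f b) (f a) (lam.get a b h)) (a : V) :
    artinLift Γ lam f hf (artinGen Γ lam a) = f a :=
  PresentedGroup.toGroup.of _

theorem artinGen_braid {a b : V} (h : Γ.Adj a b) :
    alternatingProd (artinGen Γ lam a) (artinGen Γ lam b) (lam.get a b h) =
      alternatingProd (artinGen Γ lam b) (artinGen Γ lam a) (lam.get a b h) := by
  have h1 := PresentedGroup.mk_eq_mk_of_mul_inv_mem (rels := artinRelators Γ lam) ⟨a, b, h, rfl⟩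
  rwa [map_alternatingProd, map_alternatingProd] at h1

open Classical in
/-- The bilinear form defining the Hecke representation with parameter `4`. -/
noncomputable def artinForm (s t : V) : ℝ :=
  if s = t then 1 + 4 else
    if h : Γ.Adj s t then 4 * Real.cos (Real.pi / (lam.get s t h : ℕ)) else 0

theorem artinForm_self (s : V) : artinForm Γ lam s s = 1 + 4 := by simp [artinForm]

theorem artinForm_adj {s t : V} (h : Γ.Adj s t) :
    artinForm Γ lam s t = 4 * Real.cos (Real.pi / (lam.get s t h : ℕ)) := by
  simp [artinForm, h, h.ne]

theorem artinForm_adj_symm {s t : V} (h : Γ.Adj s t) :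
    artinForm Γ lam t s = 4 * Real.cos (Real.pi / (lam.get s t h : ℕ)) := by
  rw [artinForm_adj Γ lam h.symm, SimpleGraph.EdgeLabeling.get_comm]

/-- The Hecke representation of an Artin group with parameter `4`. -/
noncomputable def heckeRep : ArtinGroup Γ lam →* (Module.End ℝ (V →₀ ℝ))ˣ :=
  artinLift Γ lam (heckeReflection (artinForm Γ lam) (artinForm_self Γ lam)) (by
    intro a b h
    have h1 := artinForm_adj Γ lam h
    have h2 := artinForm_adj_symm Γ lam h
    rcases (lam.get a b h).2.eq_or_lt with hm | hm
    · rw [← hm] at h1 h2 ⊢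
      simp only [Nat.cast_ofNat, Real.cos_pi_div_two, mul_zero] at h1 h2
      exact oneSubUnit_braid_two _ _ (rankOne_mul_eq_zero h1) (rankOne_mul_eq_zero h2)
    · refine oneSubUnit_braid hm _ _ ?_ ?_
      · rw [rankOne_mul_mul, h1, h2]; congr 1; ring
      · rw [rankOne_mul_mul, h1, h2]; congr 1; ring)

/-- The homomorphism to the integers sending each generator to `1`. -/
def lengthHom : ArtinGroup Γ lam →* Multiplicative ℤ :=
  artinLift Γ lam (fun _ => .ofAdd 1) (fun _ _ _ => rfl)

theorem AdmitsWeaklyAperiodicSFT.of_commute {G : Type*} [Group G] {u w : G} (h : Commute u w)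
    (hind : ∀ i j : ℤ, u ^ i * w ^ j = 1 → i = 0 ∧ j = 0) : AdmitsWeaklyAperiodicSFT G := by
  let f : Plane →* G := MonoidHom.mk' (fun v => u ^ v.toAdd.1 * w ^ v.toAdd.2) (by
    intro v v'
    simp only [toAdd_mul, Prod.fst_add, Prod.snd_add, zpow_add]
    exact ((h.zpow_zpow _ _).symm.mul_mul_mul_comm _ _).symm)
  refine admitsWeaklyAperiodicSFT_plane.of_injective f ((injective_iff_map_eq_one f).2 ?_)
  intro v hv
  obtain ⟨h1, h2⟩ := hind _ _ hv
  exact Multiplicative.toAdd.injective (Prod.ext h1 h2)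

theorem zpow_natAbs_cases {G : Type*} [Group G] (a : G) (i : ℤ) :
    a ^ i = a ^ i.natAbs ∨ a ^ i = (a ^ i.natAbs)⁻¹ := by
  rcases Int.natAbs_eq i with h | h
  · left; conv_lhs => rw [h, zpow_natCast]
  · right; conv_lhs => rw [h, zpow_neg, zpow_natCast]

theorem admitsWeaklyAperiodicSFT_of_adj {a b : V} (h : Γ.Adj a b) :
    AdmitsWeaklyAperiodicSFT (ArtinGroup Γ lam) := by
  have hbraid := artinGen_braid Γ lam h
  have hla : ∀ c, lengthHom Γ lam (artinGen Γ lam c) = .ofAdd 1 := artinLift_artinGen Γ lam _ _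
  have hra : ∀ c, heckeRep Γ lam (artinGen Γ lam c) = heckeReflection _ _ c :=
    artinLift_artinGen Γ lam _ _
  have hB := artinForm_adj_symm Γ lam h
  rcases hm' : lam.get a b h with ⟨m, hm⟩
  rw [hm'] at hbraid hB
  simp only at hbraid hB
  rcases hm.eq_or_lt with rfl | hm
  · have hc : Commute (artinGen Γ lam a) (artinGen Γ lam b) := by
      simpa [alternatingProd, commute_iff_eq] using hbraid
    refine .of_commute hc fun i j hij => ?_
    have hlen := congrArg (lengthHom Γ lam) hij
    simp only [map_mul, map_zpow, hla, map_one, ← ofAdd_zsmul, ← ofAdd_add, ofAdd_eq_one,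
      smul_eq_mul, mul_one] at hlen
    suffices i = 0 by omega
    by_contra hi
    -- Equal lengths turn a relation into `a ^ i = b ^ i`, which the representation excludes for `i
    -- ≠ 0`.
    obtain rfl : j = -i := by omega
    rw [zpow_neg, mul_inv_eq_one] at hij
    have hij' : artinGen Γ lam a ^ i.natAbs = artinGen Γ lam b ^ i.natAbs := by
      rcases Int.natAbs_eq i with h | h
      · rwa [h, zpow_natCast, zpow_natCast] at hij
      · rwa [h, zpow_neg, zpow_neg, zpow_natCast, zpow_natCast, inv_inj] at hij
    have := congrArg (heckeRep Γ lam) hij'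
    rw [map_pow, map_pow, hra, hra] at this
    exact heckeReflection_pow_ne_pow h.ne (Int.natAbs_ne_zero.2 hi) this
  · have hca := commute_alternatingProd_sq hbraid
    have hcb := commute_alternatingProd_sq hbraid.symm
    rw [← hbraid] at hcb
    refine .of_commute hca fun i j hij => ?_
    have hlen := congrArg (lengthHom Γ lam) hij
    simp only [map_mul, map_zpow, map_alternatingProd, hla, map_one, alternatingProd_self,
      ← ofAdd_zsmul, ← ofAdd_nsmul, ← ofAdd_add, ofAdd_eq_one, smul_eq_mul, mul_one,
      nsmul_eq_mul] at hlen
    suffices i = 0 by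
      subst this
      have : (m : ℤ) + m ≠ 0 := by omega
      simp_all
    by_contra hi
    -- A relation makes `a ^ i` a power of the squared alternating product, hence commute with `b`;
    -- the representation forbids this for `i ≠ 0`.
    have hci : Commute (artinGen Γ lam b) (artinGen Γ lam a ^ i) := by
      rw [eq_inv_of_mul_eq_one_left hij]
      exact (hcb.zpow_right j).inv_right
    have hcn : Commute (artinGen Γ lam b) (artinGen Γ lam a ^ i.natAbs) := by
      rcases zpow_natAbs_cases (artinGen Γ lam a) i with h | h
      · rwa [h] at hci
      · rwa [h, Commute.inv_right_iff] at hci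
    have := hcn.map (heckeRep Γ lam)
    rw [map_pow, hra, hra] at this
    refine not_commute_heckeReflection_pow h.ne ?_ (Int.natAbs_ne_zero.2 hi) this
    rw [hB]
    have hm3 : (3 : ℝ) ≤ m := by exact_mod_cast hm
    have hpos : 0 < Real.pi / m := by positivity
    have hlt : Real.pi / m < Real.pi / 2 := by
      apply div_lt_div_of_pos_left Real.pi_pos <;> linarith
    have := Real.cos_pos_of_mem_Ioo ⟨by linarith, hlt⟩
    positivity

/-- Without edges any assignment of the generators extends, so sending `a` to one free generator and
all other vertices to the second is a left inverse of `f`. -/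
theorem admitsWeaklyAperiodicSFT_of_forall_not_adj (hΓ : ∀ a b, ¬ Γ.Adj a b) [Nontrivial V] :
    AdmitsWeaklyAperiodicSFT (ArtinGroup Γ lam) := by
  classical
  obtain ⟨a, b, hab⟩ := exists_pair_ne V
  let f : FreeGroup Bool →* ArtinGroup Γ lam :=
    FreeGroup.lift fun c => artinGen Γ lam (if c then a else b)
  let r : ArtinGroup Γ lam →* FreeGroup Bool :=
    artinLift Γ lam (fun v => FreeGroup.of (decide (v = a))) fun a b h => absurd h (hΓ a b)
  have hrf : r.comp f = MonoidHom.id _ := by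
    ext c
    cases c <;> simp [f, r, artinLift_artinGen, hab.symm]
  exact admitsWeaklyAperiodicSFT_freeGroup_bool.of_injective f
    (Function.LeftInverse.injective (g := r) fun x => DFunLike.congr_fun hrf x)

/-- The Artin group of a one-vertex graph is infinite cyclic. -/
def artinGroupEquivInt [Unique V] : ArtinGroup Γ lam ≃* Multiplicative ℤ :=
  MonoidHom.toMulEquiv (lengthHom Γ lam) (zpowersHom _ (artinGen Γ lam default))
    (PresentedGroup.ext fun v => by
      rw [Unique.eq_default v]
      change zpowersHom _ _ (lengthHom Γ lam (artinGen Γ lam default)) = artinGen Γ lam default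
      rw [lengthHom, artinLift_artinGen]
      simp)
    (by
      ext
      simp [lengthHom, artinLift_artinGen])

end Artin

end ArtinSFT

theorem mainTheorem10 {V : Type*} [Nonempty V] (Γ : SimpleGraph V)
    (lam : Γ.EdgeLabeling {n : ℕ // 2 ≤ n})
    (hZ : IsEmpty (ArtinSFT.ArtinGroup Γ lam ≃* Multiplicative ℤ)) :
    ArtinSFT.AdmitsWeaklyAperiodicSFT (ArtinSFT.ArtinGroup Γ lam) := by
  by_cases hΓ : ∀ a b, ¬ Γ.Adj a b
  · rcases subsingleton_or_nontrivial V with hV | hV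
    · obtain ⟨_⟩ := nonempty_unique V
      exact hZ.elim (ArtinSFT.artinGroupEquivInt Γ lam)
    · exact ArtinSFT.admitsWeaklyAperiodicSFT_of_forall_not_adj Γ lam hΓ
  · push Not at hΓ
    obtain ⟨a, b, h⟩ := hΓ
    exact ArtinSFT.admitsWeaklyAperiodicSFT_of_adj Γ lam h
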